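/- Let $n\ge 3$ and let $C\subset\mathbb{R}^n$ be a polytope with $C=-C$ and $0\in\operatorname{int} C$. A convex body is a non-empty compact convex subset of $\mathbb{R}^n$. For a non-empty compact set $K\subset\mathbb{R}^n$ let $R(K,C)$ be the smallest $\lambda\ge 0$ such that a translate of $\lambda C$ contains $K$. For a convex body $K$ let $D(K,C)=2\max\{R([x,y],C):x,y\in K\}$ be its diameter and $w(K,C)=\min_{s\ne 0} 2h(K-K,s)/h(C-C,s)$ its width, where $h(A,s)=\max_{x\in A}s^Tx$. The body $K$ is complete with respect to $C$ if $D(K',C)>D(K,C)$ for every convex body $K'\supsetneq K$, and it is of constant width with respect to $C$ if $w(K,C)=D(K,C)$. Suppose that $C$ is perfect, i.e., every convex body that is complete with respect to $C$ is of constant width with respect to $C$. Then any two facets $F_1,F_2$ of $C$ with $F_1\cap F_2\neq\emptyset$ intersect in at least an edge of $C$, i.e., there is an edge $E$ of $C$ with $E\subset F_1\cap F_2$. -/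

import Mathlib

open scoped Pointwise

noncomputable section

namespace MinkowskiGeometry

variable {n : ℕ}

/-- The support function `h(K, a) = max {aᵀx : x ∈ K}`. -/
def supportFun (K : Set (EuclideanSpace ℝ (Fin n))) (a : EuclideanSpace ℝ (Fin n)) : ℝ :=
  sSup ((fun x => inner ℝ a x) '' K)

/-- The circumradius `R(K, C)`: the smallest `r ≥ 0` such that some translate of `r C`
contains `K`. -/
def circumradius (K C : Set (EuclideanSpace ℝ (Fin n))) : ℝ :=
  sInf {r : ℝ | 0 ≤ r ∧ ∃ c : EuclideanSpace ℝ (Fin n), K ⊆ c +ᵥ (r • C)}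

/-- The diameter `D(K, C) = 2 max {R([x, y], C) : x, y ∈ K}`. -/
def diameter (K C : Set (EuclideanSpace ℝ (Fin n))) : ℝ :=
  2 * sSup {r : ℝ | ∃ x ∈ K, ∃ y ∈ K, r = circumradius (segment ℝ x y) C}

/-- The breadth `b_s(K, C) = 2 h(K - K, s) / h(C - C, s)` in direction `s`. -/
def breadth (K C : Set (EuclideanSpace ℝ (Fin n))) (s : EuclideanSpace ℝ (Fin n)) : ℝ :=
  2 * supportFun (K - K) s / supportFun (C - C) s

/-- The (minimal) width `w(K, C) = min {b_s(K, C) : s ≠ 0}`. -/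
def width (K C : Set (EuclideanSpace ℝ (Fin n))) : ℝ :=
  sInf {b : ℝ | ∃ s : EuclideanSpace ℝ (Fin n), s ≠ 0 ∧ b = breadth K C s}

/-- `K` is complete with respect to `C`: every convex body properly containing `K` has a larger
diameter. -/
def IsComplete (K C : ConvexBody (EuclideanSpace ℝ (Fin n))) : Prop :=
  ∀ K' : ConvexBody (EuclideanSpace ℝ (Fin n)),
    (K : Set (EuclideanSpace ℝ (Fin n))) ⊂ K' →
      diameter (K : Set (EuclideanSpace ℝ (Fin n))) C <
        diameter (K' : Set (EuclideanSpace ℝ (Fin n))) C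

/-- `K` is of constant width with respect to `C`. -/
def IsConstantWidth (K C : ConvexBody (EuclideanSpace ℝ (Fin n))) : Prop :=
  width (K : Set (EuclideanSpace ℝ (Fin n))) C = diameter (K : Set (EuclideanSpace ℝ (Fin n))) C

/-- A gauge body: a convex body with the origin in its interior. -/
def IsGaugeBody (C : ConvexBody (EuclideanSpace ℝ (Fin n))) : Prop :=
  (0 : EuclideanSpace ℝ (Fin n)) ∈ interior (C : Set (EuclideanSpace ℝ (Fin n)))

/-- A gauge body `C` is perfect if every convex body that is complete with respect to `C` is of
constant width with respect to `C`. -/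
def IsPerfect (C : ConvexBody (EuclideanSpace ℝ (Fin n))) : Prop :=
  IsGaugeBody C ∧
    ∀ K : ConvexBody (EuclideanSpace ℝ (Fin n)), IsComplete K C → IsConstantWidth K C

/-- A polytope: the convex hull of a finite set of points. -/
def IsPolytope (P : Set (EuclideanSpace ℝ (Fin n))) : Prop :=
  ∃ V : Set (EuclideanSpace ℝ (Fin n)), V.Finite ∧ P = convexHull ℝ V

/-- `F` is a nonempty (exposed) face of `P` whose affine hull has dimension `k`. -/
def IsFaceOfDim (k : ℕ) (P F : Set (EuclideanSpace ℝ (Fin n))) : Prop :=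
  F.Nonempty ∧ IsExposed ℝ P F ∧ Module.finrank ℝ (vectorSpan ℝ F) = k

/-- A facet of an `n`-dimensional polytope in `ℝⁿ`, `n ≥ 1`: a face of dimension `n - 1`. -/
def IsFacet (P F : Set (EuclideanSpace ℝ (Fin n))) : Prop :=
  IsFaceOfDim (n - 1) P F

/-- An edge: a face of dimension `1`. -/
def IsEdge (P E : Set (EuclideanSpace ℝ (Fin n))) : Prop :=
  IsFaceOfDim 1 P E

end MinkowskiGeometry

end

/-! ### Exposed faces of polytopes, at the level of generating points -/

section ExposedFaces

variable {E : Type*} [NormedAddCommGroup E]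

/-! For symmetric `C`, `D(K, C)` is the largest gauge of a difference of points of `K`, so `D(K, C)
≤ 1` means `K - K ⊆ C`; constant width with `D ≥ 1` forces `C ⊆ K - K`.

As `n ≥ 3`, two facets share a direction. Shrinking towards a common point `p` gives parallel
segments `[q₁, q₁ + d] ⊆ F₁` and `[q₂, q₂ + d] ⊆ F₂` so short and close that all differences of `{0,
q₁ - q₂, q₁, q₁ + d}` lie in `C`. Extend this set to a complete `K` with `K - K ⊆ C`
(`exists_isComplete`). By perfectness `p = x - y` with `x, y ∈ K` (`subset_sub_of_isConstantWidth`).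
Then `(q₁ - y) + x = q₁ + p` and `(q₁ - y) + (x - (q₁ - q₂)) = q₂ + p` place `q₁ - y` in both facets
(`IsExposed.mem_of_add_eq_add`); so too `q₁ + d - y`. Thus `F₁ ∩ F₂` is an exposed face with two
points, and in a polytope such a face contains an edge. -/

lemma convexHull_inter_level_eq [NormedSpace ℝ E] {V : Set E} {l : StrongDual ℝ E} {c : ℝ}
    (hl : ∀ v ∈ V, l v ≤ c) :
    {x ∈ convexHull ℝ V | l x = c} = convexHull ℝ {v ∈ V | l v = c} := by
  apply Set.Subset.antisymm
  -- The implication is built into a convex set containing `V`, so minimality of the hull replaces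
  -- working with explicit convex combinations.
  · have hconv : Convex ℝ {x : E | l x ≤ c ∧ (l x = c → x ∈ convexHull ℝ {v ∈ V | l v = c})} := by
      refine convex_iff_forall_pos.2 ?_
      rintro x ⟨hx, hx'⟩ y ⟨hy, hy'⟩ a b ha hb hab
      have hval : l (a • x + b • y) = a * l x + b * l y := by simp
      have hc : c = a * c + b * c := by rw [← add_mul, hab, one_mul]
      have h1 := mul_le_mul_of_nonneg_left hx ha.le
      have h2 := mul_le_mul_of_nonneg_left hy hb.le
      refine ⟨by linarith, fun h => ?_⟩
      have hxc : l x = c := mul_left_cancel₀ ha.ne' (by linarith)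
      have hyc : l y = c := mul_left_cancel₀ hb.ne' (by linarith)
      exact convex_convexHull ℝ _ (hx' hxc) (hy' hyc) ha.le hb.le hab
    have hsub : V ⊆ {x : E | l x ≤ c ∧ (l x = c → x ∈ convexHull ℝ {v ∈ V | l v = c})} :=
      fun v hv => ⟨hl v hv, fun h => subset_convexHull ℝ _ ⟨hv, h⟩⟩
    exact fun x hx => (convexHull_min hsub hconv hx.1).2 hx.2
  · refine convexHull_min (fun v hv => ⟨subset_convexHull ℝ _ hv.1, hv.2⟩) ?_
    exact (convex_convexHull ℝ V).inter (convex_hyperplane l.toLinearMap.isLinear c)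

/-- `W` is the set of points of `V` on which some continuous functional attains its maximum. -/
def IsExposedSubset [NormedSpace ℝ E] (V W : Set E) : Prop :=
  ∃ (l : StrongDual ℝ E) (c : ℝ), (∀ v ∈ V, l v ≤ c) ∧ W = {v ∈ V | l v = c}

lemma convexHull_le_of_le [NormedSpace ℝ E] {V : Set E} {l : StrongDual ℝ E} {c : ℝ}
    (hl : ∀ v ∈ V, l v ≤ c) : ∀ x ∈ convexHull ℝ V, l x ≤ c :=
  fun _ hx => convexHull_min hl (convex_halfSpace_le l.toLinearMap.isLinear c) hx

lemma IsExposedSubset.isExposed_convexHull [NormedSpace ℝ E] {V W : Set E}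
    (h : IsExposedSubset V W) : IsExposed ℝ (convexHull ℝ V) (convexHull ℝ W) := by
  obtain ⟨l, c, hl, rfl⟩ := h
  intro hne
  refine ⟨l, ?_⟩
  rw [convexHull_nonempty_iff] at hne
  obtain ⟨v, hv, hvc⟩ := hne
  rw [← convexHull_inter_level_eq hl]
  have hle := convexHull_le_of_le hl
  ext x
  constructor
  · rintro ⟨hx, hxc⟩
    exact ⟨hx, fun y hy => hxc ▸ hle y hy⟩
  · rintro ⟨hx, hmax⟩
    refine ⟨hx, le_antisymm (hle x hx) ?_⟩
    rw [← hvc]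
    exact hmax v (subset_convexHull ℝ _ hv)

lemma IsExposed.exists_isExposedSubset [NormedSpace ℝ E] {V B : Set E}
    (h : IsExposed ℝ (convexHull ℝ V) B) (hB : B.Nonempty) :
    ∃ W, IsExposedSubset V W ∧ B = convexHull ℝ W := by
  obtain ⟨l, hl⟩ := h hB
  obtain ⟨z, hz⟩ := hB
  have hz' := hl ▸ hz
  have hle : ∀ v ∈ V, l v ≤ l z := fun v hv => hz'.2 v (subset_convexHull ℝ _ hv)
  refine ⟨_, ⟨l, l z, hle, rfl⟩, ?_⟩
  rw [← convexHull_inter_level_eq hle, hl]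
  ext x
  constructor
  · rintro ⟨hx, hmax⟩
    exact ⟨hx, le_antisymm (hz'.2 x hx) (hmax z hz'.1)⟩
  · rintro ⟨hx, hxc⟩
    exact ⟨hx, fun y hy => hxc ▸ hz'.2 y hy⟩

/-- Perturb lexicographically: for large `N`, `N • l + m` first maximizes `l`, then `m`. Finiteness
of `V` gives one `N` for all points. -/
lemma IsExposedSubset.trans [NormedSpace ℝ E] {V W U : Set E} (hV : V.Finite)
    (hW : IsExposedSubset V W) (hU : IsExposedSubset W U) : IsExposedSubset V U := by
  obtain ⟨l, c, hl, rfl⟩ := hW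
  obtain ⟨m, d, hm, rfl⟩ := hU
  have hev : ∀ᶠ N : ℝ in Filter.atTop, ∀ v ∈ V, l v < c → m v - d < N * (c - l v) := by
    rw [Filter.eventually_all_finite hV]
    intro v _
    by_cases h : l v < c
    · filter_upwards [Filter.eventually_gt_atTop ((m v - d) / (c - l v))] with N hN _
      exact (div_lt_iff₀ (sub_pos.2 h)).1 hN
    · exact Filter.Eventually.of_forall fun N h' => absurd h' h
  obtain ⟨N, hN⟩ := hev.exists
  refine ⟨N • l + m, N * c + d, fun v hv => ?_, ?_⟩
  · simp only [add_apply, smul_apply, smul_eq_mul]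
    rcases (hl v hv).lt_or_eq with h | h
    · linarith [hN v hv h]
    · rw [h]; linarith [hm v ⟨hv, h⟩]
  · ext v
    simp only [Set.mem_ofPred_eq, add_apply, smul_apply,
      smul_eq_mul]
    constructor
    · rintro ⟨⟨hv, h⟩, h'⟩
      exact ⟨hv, by rw [h, h']⟩
    · rintro ⟨hv, h⟩
      rcases (hl v hv).lt_or_eq with h' | h'
      · linarith [hN v hv h']
      · rw [h'] at h
        exact ⟨⟨hv, h'⟩, by linarith⟩

lemma exists_ne_of_apply_ne_zero [NormedSpace ℝ E] {W : Set E} {m : StrongDual ℝ E} {e : E}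
    (he : e ∈ vectorSpan ℝ W) (hme : m e ≠ 0) (w₀ : E) : ∃ w ∈ W, m w ≠ m w₀ := by
  by_contra! h
  have hle : vectorSpan ℝ W ≤ LinearMap.ker m.toLinearMap := by
    refine Submodule.span_le.2 ?_
    rintro _ ⟨x, hx, y, hy, rfl⟩
    simp [h x hx, h y hy]
  exact hme (hle he)

/-- Rotating a supporting hyperplane: a finite set of affine dimension at least two has a proper
exposed subset with at least two points. -/
lemma exists_nontrivial_exposedSubset_ne [InnerProductSpace ℝ E] [FiniteDimensional ℝ E]
    {W : Set E} (hW : W.Finite) (hdim : 2 ≤ Module.finrank ℝ (vectorSpan ℝ W)) :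
    ∃ U, IsExposedSubset W U ∧ U.Nontrivial ∧ U ⊂ W := by
  have hproper : ∀ (m : StrongDual ℝ E) (c : ℝ) (e : E), e ∈ vectorSpan ℝ W → m e ≠ 0 →
      (∃ w₀, m w₀ = c) → {v ∈ W | m v = c} ⊂ W := by
    rintro m c e he hme ⟨w₀, rfl⟩
    obtain ⟨w, hw, hne⟩ := exists_ne_of_apply_ne_zero he hme w₀
    exact ⟨fun v hv => hv.1, fun h => hne (h hw).2⟩
  have hpos : 0 < Module.finrank ℝ (vectorSpan ℝ W) := by omega
  obtain ⟨⟨s, hs⟩, hs0⟩ := Module.finrank_pos_iff_exists_ne_zero.1 hpos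
  have hs0' : s ≠ 0 := fun h => hs0 (Subtype.ext h)
  set l : StrongDual ℝ E := innerSL ℝ s
  have hls : l s ≠ 0 := by simpa [l] using hs0'
  have hne : W.Nonempty := by
    obtain ⟨w, hw, -⟩ := exists_ne_of_apply_ne_zero hs hls 0
    exact ⟨w, hw⟩
  obtain ⟨w₀, hw₀, hmax⟩ := Set.exists_max_image W l hW hne
  by_cases huniq : ∃ w ∈ W, w ≠ w₀ ∧ l w = l w₀
  · obtain ⟨w, hw, hww, hlw⟩ := huniq
    exact ⟨_, ⟨l, l w₀, hmax, rfl⟩, ⟨w, ⟨hw, hlw⟩, w₀, ⟨hw₀, rfl⟩, hww⟩,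
      hproper l _ s hs hls ⟨w₀, rfl⟩⟩
  have hlt : ∀ w ∈ W, w ≠ w₀ → l w < l w₀ := fun w hw hww =>
    (hmax w hw).lt_of_ne fun h => huniq ⟨w, hw, hww, h⟩
  -- Now `w₀` is the unique maximizer of `l`, and `l` is tilted along a direction in its kernel.
  obtain ⟨d₀, hd₀, hd₀0, hld₀⟩ : ∃ d ∈ vectorSpan ℝ W, d ≠ 0 ∧ l d = 0 := by
    have hker := LinearMap.ker_ne_bot_of_finrank_lt
      (f := l.toLinearMap.domRestrict (vectorSpan ℝ W)) (by simp; omega)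
    obtain ⟨⟨d, hd⟩, hdk, hd0⟩ := Submodule.exists_mem_ne_zero_of_ne_bot hker
    exact ⟨d, hd, fun h => hd0 (Subtype.ext h), by simpa using hdk⟩
  obtain ⟨d, hd, hd0, hld, w₁, hw₁, hgt⟩ : ∃ d ∈ vectorSpan ℝ W, d ≠ 0 ∧ l d = 0 ∧
      ∃ w ∈ W, innerSL ℝ d w₀ < innerSL ℝ d w := by
    obtain ⟨w, hw, hww⟩ := exists_ne_of_apply_ne_zero (m := innerSL ℝ d₀) hd₀
      (by simpa using hd₀0) w₀
    rcases lt_or_gt_of_ne hww with h | h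
    · exact ⟨-d₀, neg_mem hd₀, neg_ne_zero.2 hd₀0, by simp [hld₀], w, hw, by simpa using h⟩
    · exact ⟨d₀, hd₀, hd₀0, hld₀, w, hw, h⟩
  set k : StrongDual ℝ E := innerSL ℝ d
  have hkd : k d ≠ 0 := by simpa [k] using hd0
  obtain ⟨w₂, ⟨hw₂, hgt₂⟩, hmin⟩ := Set.exists_min_image {w ∈ W | k w₀ < k w}
    (fun w => (l w₀ - l w) / (k w - k w₀)) (hW.subset fun w hw => hw.1) ⟨w₁, hw₁, hgt⟩
  -- The first tilt at which another point ties with `w₀`.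
  set t := (l w₀ - l w₂) / (k w₂ - k w₀)
  have hw₂₀ : w₂ ≠ w₀ := fun h => by simp [h] at hgt₂
  have htpos : 0 < t := div_pos (sub_pos.2 (hlt w₂ hw₂ hw₂₀)) (sub_pos.2 hgt₂)
  have htie : t * (k w₂ - k w₀) = l w₀ - l w₂ := div_mul_cancel₀ _ (sub_pos.2 hgt₂).ne'
  have hm : ∀ x, (l + t • k) x = l x + t * k x := fun x => by simp
  refine ⟨{v ∈ W | (l + t • k) v = (l + t • k) w₀}, ⟨l + t • k, _, fun v hv => ?_, rfl⟩,
    ⟨w₂, ⟨hw₂, ?_⟩, w₀, ⟨hw₀, rfl⟩, hw₂₀⟩, hproper _ _ d hd ?_ ⟨w₀, rfl⟩⟩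
  · rw [hm, hm]
    rcases lt_or_ge (k w₀) (k v) with h | h
    · have := (le_div_iff₀ (sub_pos.2 h)).1 (hmin v ⟨hv, h⟩)
      linarith
    · linarith [hmax v hv, mul_le_mul_of_nonneg_left h htpos.le]
  · rw [hm, hm]; linarith
  · rw [hm, hld, zero_add]
    exact mul_ne_zero htpos.ne' hkd

/-- Descent on the number of points: while the dimension exceeds one, pass to a smaller nontrivial
exposed subset. -/
lemma exists_exposedSubset_finrank_eq_one [InnerProductSpace ℝ E] [FiniteDimensional ℝ E]
    {V : Set E} (hV : V.Finite) {W : Set E} (hW : IsExposedSubset V W) (hWnt : W.Nontrivial) :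
    ∃ U, U ⊆ W ∧ IsExposedSubset V U ∧ U.Nonempty ∧ Module.finrank ℝ (vectorSpan ℝ U) = 1 := by
  have hWfin : W.Finite := by
    obtain ⟨l, c, -, rfl⟩ := hW
    exact hV.subset fun v hv => hv.1
  induction hk : W.ncard using Nat.strong_induction_on generalizing W with
  | _ k ih =>
    by_cases h1 : Module.finrank ℝ (vectorSpan ℝ W) = 1
    · exact ⟨W, subset_rfl, hW, hWnt.nonempty, h1⟩
    have hpos : Module.finrank ℝ (vectorSpan ℝ W) ≠ 0 := by
      intro h0
      obtain ⟨x, hx, y, hy, hxy⟩ := hWnt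
      have hmem := vsub_mem_vectorSpan ℝ hx hy
      rw [Submodule.finrank_eq_zero.1 h0, Submodule.mem_bot, vsub_eq_sub, sub_eq_zero] at hmem
      exact hxy hmem
    obtain ⟨U, hU, hUnt, hUW⟩ := exists_nontrivial_exposedSubset_ne hWfin (by omega)
    obtain ⟨U', hU', h⟩ := ih _ (hk ▸ Set.ncard_lt_ncard hUW hWfin) (hW.trans hV hU) hUnt
      (hWfin.subset hUW.subset) rfl
    exact ⟨U', hU'.trans hUW.subset, h⟩

/-- A nontrivial exposed face of a polytope contains a one-dimensional exposed face. -/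
lemma IsExposed.exists_isExposed_finrank_eq_one [InnerProductSpace ℝ E] [FiniteDimensional ℝ E]
    {V B : Set E} (hV : V.Finite) (hB : IsExposed ℝ (convexHull ℝ V) B) (hBnt : B.Nontrivial) :
    ∃ F ⊆ B, F.Nonempty ∧ IsExposed ℝ (convexHull ℝ V) F ∧
      Module.finrank ℝ (vectorSpan ℝ F) = 1 := by
  obtain ⟨W, hW, rfl⟩ := hB.exists_isExposedSubset hBnt.nonempty
  have hWnt : W.Nontrivial := by
    by_contra h
    rw [Set.not_nontrivial_iff] at h
    rcases h.eq_empty_or_singleton with rfl | ⟨x, rfl⟩ <;> simp at hBnt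
  obtain ⟨U, hUW, hU, hUne, hdim⟩ := exists_exposedSubset_finrank_eq_one hV hW hWnt
  refine ⟨convexHull ℝ U, convexHull_mono hUW, hUne.convexHull, hU.isExposed_convexHull, ?_⟩
  rw [← direction_affineSpan, affineSpan_convexHull, direction_affineSpan, hdim]

end ExposedFaces

/-! ### Direction vectors of convex sets -/

section VectorSpan

variable {E : Type*} [AddCommGroup E] [Module ℝ E]

/-- Small multiples of a direction vector of a convex set are realized as differences. -/
lemma Convex.exists_add_smul_mem_of_mem_vectorSpan {F : Set E} (hF : Convex ℝ F)
    (hne : F.Nonempty) {v : E} (hv : v ∈ vectorSpan ℝ F) :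
    ∃ r : ℝ, 0 < r ∧ ∃ x ∈ F, x + r • v ∈ F := by
  let S : Submodule ℝ E :=
    { carrier := {v | ∃ r : ℝ, 0 < r ∧ ∃ x ∈ F, x + r • v ∈ F}
      zero_mem' := by
        obtain ⟨x, hx⟩ := hne
        exact ⟨1, one_pos, x, hx, by simpa using hx⟩
      add_mem' := by
        rintro v w ⟨r, hr, x, hx, hxv⟩ ⟨s, hs, y, hy, hyw⟩
        have hrs : 0 < r + s := add_pos hr hs
        have ha : 0 ≤ s / (r + s) := by positivity
        have hb : 0 ≤ r / (r + s) := by positivity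
        have hab : s / (r + s) + r / (r + s) = 1 := by field_simp; ring
        -- The weights `s / (r + s)` and `r / (r + s)` scale both steps `r` and `s` to the same
        -- length.
        refine ⟨r * s / (r + s), by positivity, _, hF hx hy ha hb hab, ?_⟩
        convert hF hxv hyw ha hb hab using 1
        have h1 : r * s / (r + s) = s / (r + s) * r := by ring
        have h2 : r * s / (r + s) = r / (r + s) * s := by ring
        rw [smul_add, smul_add, smul_add, smul_smul, smul_smul, ← h1, ← h2]
        abel
      smul_mem' := by
        rintro c v ⟨r, hr, x, hx, hxv⟩
        rcases lt_trichotomy c 0 with hc | rfl | hc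
        · refine ⟨r / (-c), div_pos hr (neg_pos.2 hc), x + r • v, hxv, ?_⟩
          have h : r / (-c) * c = -r := by
            rw [div_neg, neg_mul, div_mul_cancel₀ _ hc.ne]
          rw [smul_smul, h]
          simpa using hx
        · exact ⟨1, one_pos, x, hx, by simpa using hx⟩
        · refine ⟨r / c, div_pos hr hc, x, hx, ?_⟩
          rwa [smul_smul, div_mul_cancel₀ _ hc.ne'] }
  have hle : vectorSpan ℝ F ≤ S := by
    refine Submodule.span_le.2 ?_
    rintro _ ⟨x, hx, y, hy, rfl⟩
    exact ⟨1, one_pos, y, hy, by simpa using hx⟩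
  exact hle hv

end VectorSpan

/-! ### Circumradius of a segment as half a gauge -/

section Gauge

variable {E : Type*} [NormedAddCommGroup E] [NormedSpace ℝ E]

lemma sub_mem_smul_of_subset_vadd {C : Set E} (hC : Convex ℝ C) (hsymm : -C = C)
    {r : ℝ} (hr : 0 ≤ r) {c x y : E} (hx : x ∈ c +ᵥ r • C) (hy : y ∈ c +ᵥ r • C) :
    x - y ∈ (2 * r) • C := by
  obtain ⟨_, ⟨a, ha, rfl⟩, rfl⟩ := hx
  obtain ⟨_, ⟨b, hb, rfl⟩, rfl⟩ := hy
  rw [two_mul, hC.add_smul hr hr]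
  refine ⟨_, Set.smul_mem_smul_set ha, _, Set.smul_mem_smul_set (a := r) (b := -b) ?_, ?_⟩
  · rwa [← hsymm, Set.neg_mem_neg]
  · simp only [smul_neg, vadd_eq_add]; abel

end Gauge

namespace MinkowskiGeometry

variable {n : ℕ} {C : Set (EuclideanSpace ℝ (Fin n))}

lemma segment_subset_vadd_smul (hC : Convex ℝ C) (hsymm : -C = C) {s : ℝ}
    {x y : EuclideanSpace ℝ (Fin n)} (hxy : x - y ∈ s • C) :
    segment ℝ x y ⊆ ((1 / 2 : ℝ) • (x + y)) +ᵥ (s / 2) • C := by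
  obtain ⟨z, hz, hzx⟩ := hxy
  have hz' : (s / 2) • z = (1 / 2 : ℝ) • (x - y) := by
    rw [← hzx, smul_smul]; congr 1; ring
  refine ((hC.smul (s / 2)).vadd _).segment_subset ?_ ?_
  · refine ⟨_, Set.smul_mem_smul_set hz, ?_⟩
    simp only [hz', vadd_eq_add]; module
  · refine ⟨_, Set.smul_mem_smul_set (a := s / 2) (b := -z) ?_, ?_⟩
    · rwa [← hsymm, Set.neg_mem_neg]
    simp only [smul_neg, hz', vadd_eq_add]; module

lemma circumradius_segment_le (hC : Convex ℝ C) (hsymm : -C = C)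
    {s : ℝ} (hs : 0 ≤ s) {x y : EuclideanSpace ℝ (Fin n)} (hxy : x - y ∈ s • C) :
    circumradius (segment ℝ x y) C ≤ s / 2 :=
  csInf_le ⟨0, fun _ hr => hr.1⟩ ⟨by positivity, _, segment_subset_vadd_smul hC hsymm hxy⟩

lemma half_gauge_le_circumradius_segment (hC : Convex ℝ C) (hsymm : -C = C)
    (h0 : (0 : EuclideanSpace ℝ (Fin n)) ∈ interior C) (x y : EuclideanSpace ℝ (Fin n)) :
    gauge C (x - y) / 2 ≤ circumradius (segment ℝ x y) C := by
  refine le_csInf ?_ ?_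
  -- Some radius must be admissible, since the real `sInf` of the empty set is `0`.
  · have habs : Absorbent ℝ C := absorbent_nhds_zero (mem_interior_iff_mem_nhds.1 h0)
    obtain ⟨r, hr, hxy⟩ := (habs (x - y)).exists_pos
    have hmem := hxy r (by simp [abs_of_pos hr]) (Set.mem_singleton _)
    exact ⟨r / 2, by positivity, _, segment_subset_vadd_smul hC hsymm hmem⟩
  · rintro r ⟨hr, c, hc⟩
    have := gauge_le_of_mem (by positivity) (sub_mem_smul_of_subset_vadd hC hsymm hr
      (hc (left_mem_segment ℝ x y)) (hc (right_mem_segment ℝ x y)))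
    linarith

end MinkowskiGeometry

lemma IsCompact.sub_self {E : Type*} [NormedAddCommGroup E] {K : Set E} (hK : IsCompact K) :
    IsCompact (K - K) := by
  rw [sub_eq_add_neg]
  exact hK.add hK.neg

/-! ### Exposed faces of a symmetric body and small parallel segments -/

section ExposedGauge

variable {E : Type*} [NormedAddCommGroup E] [NormedSpace ℝ E]

/-- The exposing functional sums to twice its maximum on `c` and `d`, so it is maximal at each. -/
lemma IsExposed.mem_of_add_eq_add {C F : Set E} (hF : IsExposed ℝ C F) {a b c d : E} (ha : a ∈ F) (hb : b ∈ F) (hc : c ∈ C)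
    (hd : d ∈ C) (h : c + d = a + b) : c ∈ F := by
  obtain ⟨l, rfl⟩ := hF ⟨a, ha⟩
  refine ⟨hc, fun y hy => ?_⟩
  have h1 := congrArg l h
  rw [map_add, map_add] at h1
  linarith [ha.2 y hy, hb.2 d hd]

/-- If `z = r • w` with `r < 1` and `w ∈ C`, the maximum of the exposing functional is at most `0`;
by symmetry it vanishes on `C`, so `F = C`. -/
lemma IsExposed.one_le_gauge {C F : Set E} (hsymm : -C = C) (h0 : (0 : E) ∈ interior C) (hF : IsExposed ℝ C F)
    (hFC : F ≠ C) {z : E} (hz : z ∈ F) : 1 ≤ gauge C z := by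
  by_contra! hlt
  obtain ⟨r, hr0, hr1, w, hw, rfl⟩ := exists_lt_of_gauge_lt
    (absorbent_nhds_zero (mem_interior_iff_mem_nhds.1 h0)) hlt
  obtain ⟨l, rfl⟩ := hF ⟨_, hz⟩
  have h1 := hz.2 w hw
  have h2 := hz.2 0 (interior_subset h0)
  simp only [map_smul, smul_eq_mul, map_zero] at h1 h2
  have hmax : ∀ y ∈ C, l y ≤ 0 := fun y hy => by
    have := hz.2 y hy
    simp only [map_smul, smul_eq_mul] at this
    nlinarith
  refine hFC (Set.Subset.antisymm (fun x hx => hx.1) fun x hx => ⟨hx, fun y hy => ?_⟩)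
  have hnx := hmax (-x) (by rwa [← hsymm, Set.neg_mem_neg])
  rw [map_neg] at hnx
  linarith [hmax y hy]

/-- A direction common to two convex sets with a common point is realized by small parallel
segments close to that point. -/
lemma exists_small_parallel_segments {F₁ F₂ C : Set E} (hF₁ : Convex ℝ F₁) (hF₂ : Convex ℝ F₂)
    (hC : (0 : E) ∈ interior C) {p b : E} (hp₁ : p ∈ F₁) (hp₂ : p ∈ F₂) (hb : b ≠ 0)
    (hb₁ : b ∈ vectorSpan ℝ F₁) (hb₂ : b ∈ vectorSpan ℝ F₂) :
    ∃ q₁ q₂ d : E, d ≠ 0 ∧ q₁ ∈ F₁ ∧ q₁ + d ∈ F₁ ∧ q₂ ∈ F₂ ∧ q₂ + d ∈ F₂ ∧ d ∈ C ∧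
      q₁ - q₂ ∈ C := by
  obtain ⟨r₁, hr₁, x₁, hx₁, hxb₁⟩ := hF₁.exists_add_smul_mem_of_mem_vectorSpan ⟨p, hp₁⟩ hb₁
  obtain ⟨r₂, hr₂, x₂, hx₂, hxb₂⟩ := hF₂.exists_add_smul_mem_of_mem_vectorSpan ⟨p, hp₂⟩ hb₂
  have hshrink : ∀ {F : Set E}, Convex ℝ F → ∀ {x : E} {r s : ℝ}, x ∈ F → x + r • b ∈ F →
      0 < s → s ≤ r → x + s • b ∈ F := by
    intro F hF x r s hx hxb hs hsr
    have hr : 0 < r := hs.trans_le hsr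
    have h := hF.add_smul_mem hx hxb (t := s / r) ⟨by positivity, (div_le_one hr).2 hsr⟩
    rwa [smul_smul, div_mul_cancel₀ _ hr.ne'] at h
  set r := min r₁ r₂
  have hr : 0 < r := lt_min hr₁ hr₂
  have hy₁ := hshrink hF₁ hx₁ hxb₁ hr (min_le_left _ _)
  have hy₂ := hshrink hF₂ hx₂ hxb₂ hr (min_le_right _ _)
  have hsmall : ∀ v : E, ∀ᶠ t : ℝ in nhdsWithin 0 (Set.Ioi 0), t • v ∈ C := by
    intro v
    have hcont : Filter.Tendsto (fun t : ℝ => t • v) (nhds 0) (nhds 0) := by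
      have : Continuous fun t : ℝ => t • v := by fun_prop
      simpa using this.tendsto 0
    exact (hcont.mono_left nhdsWithin_le_nhds) (mem_interior_iff_mem_nhds.1 hC)
  obtain ⟨t, ⟨⟨htb, htx⟩, ht1⟩, ht0⟩ := (((hsmall (r • b)).and (hsmall (x₁ - x₂))).and
    ((eventually_le_nhds (zero_lt_one' ℝ)).filter_mono nhdsWithin_le_nhds)).and
    self_mem_nhdsWithin |>.exists
  have ht : t ∈ Set.Icc (0 : ℝ) 1 := ⟨le_of_lt ht0, ht1⟩
  -- Both segments are contracted towards `p` by the same ratio `t`.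
  refine ⟨p + t • (x₁ - p), p + t • (x₂ - p), t • r • b,
    smul_ne_zero (ne_of_gt ht0) (smul_ne_zero hr.ne' hb), hF₁.add_smul_sub_mem hp₁ hx₁ ht, ?_,
    hF₂.add_smul_sub_mem hp₂ hx₂ ht, ?_, htb, ?_⟩
  · convert hF₁.add_smul_sub_mem hp₁ hy₁ ht using 1; module
  · convert hF₂.add_smul_sub_mem hp₂ hy₂ ht using 1; module
  · convert htx using 1; module

end ExposedGauge

/-! ### Diameter, completion and constant width -/

namespace MinkowskiGeometry

variable {n : ℕ} {C : Set (EuclideanSpace ℝ (Fin n))}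

lemma diameter_le_one (hC : Convex ℝ C) (hsymm : -C = C)
    {K : Set (EuclideanSpace ℝ (Fin n))} (hne : K.Nonempty) (hK : K - K ⊆ C) :
    diameter K C ≤ 1 := by
  obtain ⟨z, hz⟩ := hne
  have : sSup {r : ℝ | ∃ x ∈ K, ∃ y ∈ K, r = circumradius (segment ℝ x y) C} ≤ 1 / 2 := by
    refine csSup_le ⟨_, z, hz, z, hz, rfl⟩ ?_
    rintro _ ⟨x, hx, y, hy, rfl⟩
    refine circumradius_segment_le hC hsymm zero_le_one ?_
    rw [one_smul]
    exact hK (Set.sub_mem_sub hx hy)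
  unfold diameter
  linarith

lemma gauge_sub_le_diameter (hC : Convex ℝ C) (hsymm : -C = C)
    (h0 : (0 : EuclideanSpace ℝ (Fin n)) ∈ interior C)
    {K : Set (EuclideanSpace ℝ (Fin n))} (hK : IsCompact K)
    {x y : EuclideanSpace ℝ (Fin n)} (hx : x ∈ K) (hy : y ∈ K) :
    gauge C (x - y) ≤ diameter K C := by
  have hbdd : BddAbove {r : ℝ | ∃ x ∈ K, ∃ y ∈ K, r = circumradius (segment ℝ x y) C} := by
    have hb : Bornology.IsVonNBounded ℝ (K - K) := (NormedSpace.isVonNBounded_iff ℝ).2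
      (hK.sub_self).isBounded
    obtain ⟨r, hr, h⟩ := (hb (mem_interior_iff_mem_nhds.1 h0)).exists_pos
    have hsub := h r (by simp [abs_of_pos hr])
    refine ⟨r / 2, ?_⟩
    rintro _ ⟨x, hx, y, hy, rfl⟩
    exact circumradius_segment_le hC hsymm hr.le (hsub (Set.sub_mem_sub hx hy))
  have h1 := half_gauge_le_circumradius_segment hC hsymm h0 x y
  have h2 := le_csSup hbdd ⟨x, hx, y, hy, rfl⟩
  unfold diameter
  linarith

lemma exists_maximal_sub_subset {A : Set (EuclideanSpace ℝ (Fin n))} (hA : A - A ⊆ C) :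
    ∃ K, A ⊆ K ∧ Maximal (fun K => K - K ⊆ C) K := by
  refine zorn_subset_nonempty {K | K - K ⊆ C} (fun c hc hchain _ => ?_) A hA
  refine ⟨⋃₀ c, ?_, fun s hs => Set.subset_sUnion_of_mem hs⟩
  rintro _ ⟨x, ⟨s, hs, hx⟩, y, ⟨t, ht, hy⟩, rfl⟩
  rcases hchain.total hs ht with h | h
  · exact hc ht (Set.sub_mem_sub (h hx) hy)
  · exact hc hs (Set.sub_mem_sub hx (h hy))

/-- A point whose differences with all of `K` lie in `C` can be adjoined to `K`, hence is already
there. Closedness and convexity of `K` follow from this form. -/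
lemma eq_iInter_of_maximal (hsymm : -C = C) (h0 : (0 : EuclideanSpace ℝ (Fin n)) ∈ C)
    {K : Set (EuclideanSpace ℝ (Fin n))} (hK : Maximal (fun K => K - K ⊆ C) K) :
    K = ⋂ x ∈ K, (fun z => z - x) ⁻¹' C := by
  apply Set.Subset.antisymm
  · exact fun z hz => Set.mem_iInter₂.2 fun x hx => hK.prop (Set.sub_mem_sub hz hx)
  · intro z hz
    have hzC : ∀ x ∈ K, z - x ∈ C := fun x hx => Set.mem_iInter₂.1 hz x hx
    have hzC' : ∀ x ∈ K, x - z ∈ C := fun x hx => by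
      rw [← hsymm, ← neg_sub, Set.neg_mem_neg]; exact hzC x hx
    refine hK.le_of_ge (y := insert z K) ?_ (Set.subset_insert z K) (Set.mem_insert z K)
    rintro _ ⟨x, rfl | hx, y, rfl | hy, rfl⟩
    · simpa using h0
    · exact hzC y hy
    · exact hzC' x hx
    · exact hK.prop (Set.sub_mem_sub hx hy)

/-- Every nonempty set whose differences lie in `C` extends to a complete body of diameter at
most one. -/
lemma exists_isComplete (C : ConvexBody (EuclideanSpace ℝ (Fin n)))
    (hsymm : -(C : Set (EuclideanSpace ℝ (Fin n))) = C) (hC : IsGaugeBody C)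
    {A : Set (EuclideanSpace ℝ (Fin n))} (hne : A.Nonempty) (hA : A - A ⊆ C) :
    ∃ K : ConvexBody (EuclideanSpace ℝ (Fin n)), A ⊆ K ∧
      (K : Set (EuclideanSpace ℝ (Fin n))) - K ⊆ C ∧ IsComplete K C := by
  obtain ⟨K, hAK, hK⟩ := exists_maximal_sub_subset hA
  have hKne := hne.mono hAK
  have heq := eq_iInter_of_maximal hsymm (interior_subset hC) hK
  have hclosed : IsClosed K := by
    rw [heq]
    exact isClosed_biInter fun x _ => C.isClosed.preimage (continuous_sub_right x)
  have hconv : Convex ℝ K := by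
    rw [heq]
    refine convex_iInter₂ fun x _ => ?_
    simpa only [sub_eq_add_neg] using C.convex.translate_preimage_left (-x)
  have hcomp : IsCompact K := by
    obtain ⟨x, hx⟩ := hKne
    refine ((Homeomorph.subRight x).isCompact_preimage.2 C.isCompact).of_isClosed_subset hclosed ?_
    exact fun z hz => hK.prop (Set.sub_mem_sub hz hx)
  refine ⟨⟨K, hconv, hcomp, hKne⟩, hAK, hK.prop, fun K' hKK' => ?_⟩
  have hnot : ¬ ((K' : Set (EuclideanSpace ℝ (Fin n))) - K' ⊆ C) := fun h =>
    hKK'.2 (hK.le_of_ge h hKK'.1)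
  obtain ⟨_, ⟨x, hx, y, hy, rfl⟩, hxy⟩ := Set.not_subset.1 hnot
  have hgt : 1 < gauge (C : Set (EuclideanSpace ℝ (Fin n))) (x - y) := by
    by_contra! h
    rw [gauge_le_one_iff_mem_closure C.convex (mem_interior_iff_mem_nhds.1 hC),
      C.isClosed.closure_eq] at h
    exact hxy h
  calc diameter K (C : Set (EuclideanSpace ℝ (Fin n))) ≤ 1 :=
        diameter_le_one C.convex hsymm hKne hK.prop
    _ < _ := hgt
    _ ≤ _ := gauge_sub_le_diameter C.convex hsymm hC K'.isCompact hx hy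

lemma bddAbove_inner_image {K : Set (EuclideanSpace ℝ (Fin n))} (hK : IsCompact K)
    (s : EuclideanSpace ℝ (Fin n)) : BddAbove ((fun x => inner ℝ s x) '' K) :=
  (hK.image (by fun_prop)).bddAbove

/-- A body of constant width at least one has every point of `C` as a difference. -/
lemma subset_sub_of_isConstantWidth (C K : ConvexBody (EuclideanSpace ℝ (Fin n)))
    (hsymm : -(C : Set (EuclideanSpace ℝ (Fin n))) = C) (hK : IsConstantWidth K C)
    (hdiam : 1 ≤ diameter (K : Set (EuclideanSpace ℝ (Fin n))) C) :
    (C : Set (EuclideanSpace ℝ (Fin n))) ⊆ (K : Set (EuclideanSpace ℝ (Fin n))) - K := by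
  have hKK := K.isCompact.sub_self
  have hCC := C.isCompact.sub_self
  intro z hz
  by_contra hzK
  -- If `z ∉ K - K`, a separating direction has `h(K - K, s) ≤ u < f z ≤ h(C - C, s) / 2`, so
  -- breadth below `1`.
  obtain ⟨f, u, hfu, huz⟩ := geometric_hahn_banach_closed_point (K.convex.sub K.convex)
    hKK.isClosed hzK
  set s := (InnerProductSpace.toDual ℝ (EuclideanSpace ℝ (Fin n))).symm f with hs
  have hsf : ∀ x, inner ℝ s x = f x := fun x => by simp [hs]
  obtain ⟨k, hk⟩ := K.nonempty
  have h0K : (0 : EuclideanSpace ℝ (Fin n)) ∈ (K : Set (EuclideanSpace ℝ (Fin n))) - K :=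
    ⟨k, hk, k, hk, sub_self k⟩
  have hu : 0 < u := by simpa using hfu 0 h0K
  have hs0 : s ≠ 0 := by
    intro h
    have := hsf z
    rw [h, inner_zero_left] at this
    linarith
  have hnonneg : ∀ (L : ConvexBody (EuclideanSpace ℝ (Fin n))) (a : EuclideanSpace ℝ (Fin n)),
      0 ≤ supportFun (L - L : Set (EuclideanSpace ℝ (Fin n))) a := by
    intro L a
    obtain ⟨x, hx⟩ := L.nonempty
    exact le_csSup (bddAbove_inner_image (L.isCompact.sub_self) a)
      ⟨0, ⟨x, hx, x, hx, sub_self x⟩, inner_zero_right _⟩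
  have hle : width (K : Set (EuclideanSpace ℝ (Fin n))) C ≤ breadth K C s := by
    refine csInf_le ⟨0, ?_⟩ ⟨s, hs0, rfl⟩
    rintro _ ⟨a, -, rfl⟩
    exact div_nonneg (mul_nonneg zero_le_two (hnonneg K a)) (hnonneg C a)
  have hupper : supportFun (K - K : Set (EuclideanSpace ℝ (Fin n))) s ≤ u := by
    refine csSup_le ⟨_, 0, h0K, rfl⟩ ?_
    rintro _ ⟨x, hx, rfl⟩
    exact (hsf x).trans_le (hfu x hx).le
  have hlower : 2 * f z ≤ supportFun (C - C : Set (EuclideanSpace ℝ (Fin n))) s := by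
    refine le_csSup (bddAbove_inner_image hCC s) ⟨z - -z, Set.sub_mem_sub hz ?_, ?_⟩
    · rwa [← hsymm, Set.neg_mem_neg]
    · simp only [hsf, map_sub, map_neg]; ring
  have hone : 1 ≤ breadth (K : Set (EuclideanSpace ℝ (Fin n))) C s :=
    (hdiam.trans hK.ge).trans hle
  have hpos : 0 < supportFun (C - C : Set (EuclideanSpace ℝ (Fin n))) s := by linarith
  have := (one_le_div hpos).1 hone
  linarith

end MinkowskiGeometry

/-! ### Facets of a perfect body -/

namespace MinkowskiGeometry

variable {n : ℕ}

/-- Dimension count: `2 * (n - 1) - n ≥ 1`. -/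
lemma IsFacet.exists_ne_zero_mem_vectorSpan (hn : 3 ≤ n)
    {P F₁ F₂ : Set (EuclideanSpace ℝ (Fin n))} (hF₁ : IsFacet P F₁) (hF₂ : IsFacet P F₂) :
    ∃ b ≠ 0, b ∈ vectorSpan ℝ F₁ ∧ b ∈ vectorSpan ℝ F₂ := by
  have h := Submodule.finrank_sup_add_finrank_inf_eq (vectorSpan ℝ F₁) (vectorSpan ℝ F₂)
  have hle := Submodule.finrank_le (vectorSpan ℝ F₁ ⊔ vectorSpan ℝ F₂)
  rw [finrank_euclideanSpace_fin] at hle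
  rw [hF₁.2.2, hF₂.2.2] at h
  have hpos : 0 < Module.finrank ℝ ↥(vectorSpan ℝ F₁ ⊓ vectorSpan ℝ F₂) := by omega
  obtain ⟨⟨b, hb₁, hb₂⟩, hb⟩ := Module.finrank_pos_iff_exists_ne_zero.1 hpos
  exact ⟨b, fun h => hb (Subtype.ext h), hb₁, hb₂⟩

lemma IsFacet.ne_of_isGaugeBody (hn : n ≠ 0) {C : ConvexBody (EuclideanSpace ℝ (Fin n))}
    (hC : IsGaugeBody C) {F : Set (EuclideanSpace ℝ (Fin n))}
    (hF : IsFacet (C : Set (EuclideanSpace ℝ (Fin n))) F) :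
    F ≠ C := by
  rintro rfl
  have hdim := hF.2.2
  have hne : (interior (convexHull ℝ (C : Set (EuclideanSpace ℝ (Fin n))))).Nonempty := by
    rw [C.convex.convexHull_eq]
    exact ⟨0, hC⟩
  rw [← direction_affineSpan, affineSpan_eq_top_of_nonempty_interior hne,
    AffineSubspace.direction_top, finrank_top, finrank_euclideanSpace_fin] at hdim
  omega

/-- Two facets of a perfect symmetric gauge body that meet have at least two common points. -/
lemma IsPerfect.nontrivial_inter (hn : 3 ≤ n) {C : ConvexBody (EuclideanSpace ℝ (Fin n))}
    (hsymm : -(C : Set (EuclideanSpace ℝ (Fin n))) = C) (hperf : IsPerfect C)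
    {F₁ F₂ : Set (EuclideanSpace ℝ (Fin n))}
    (hF₁ : IsFacet (C : Set (EuclideanSpace ℝ (Fin n))) F₁)
    (hF₂ : IsFacet (C : Set (EuclideanSpace ℝ (Fin n))) F₂)
    (hmeet : (F₁ ∩ F₂).Nonempty) : (F₁ ∩ F₂).Nontrivial := by
  obtain ⟨hC, hcw⟩ := hperf
  obtain ⟨p, hp₁, hp₂⟩ := hmeet
  obtain ⟨b, hb, hb₁, hb₂⟩ := hF₁.exists_ne_zero_mem_vectorSpan hn hF₂
  have hx₁ := hF₁.2.1
  have hx₂ := hF₂.2.1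
  obtain ⟨q₁, q₂, d, hd, hq₁, hqd₁, hq₂, hqd₂, hdC, hqC⟩ := exists_small_parallel_segments
    (hx₁.convex C.convex) (hx₂.convex C.convex) hC hp₁ hp₂ hb hb₁ hb₂
  have h0 : (0 : EuclideanSpace ℝ (Fin n)) ∈ (C : Set (EuclideanSpace ℝ (Fin n))) :=
    interior_subset hC
  have hneg : ∀ x y : EuclideanSpace ℝ (Fin n), x - y ∈ (C : Set (EuclideanSpace ℝ (Fin n))) →
      y - x ∈ (C : Set (EuclideanSpace ℝ (Fin n))) := fun x y h => by
    rw [← neg_sub, ← hsymm, Set.neg_mem_neg]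
    exact h
  have hA : ({0, q₁ - q₂, q₁, q₁ + d} : Set (EuclideanSpace ℝ (Fin n))) -
      {0, q₁ - q₂, q₁, q₁ + d} ⊆ C := by
    have h1 : q₁ - q₂ - 0 ∈ (C : Set (EuclideanSpace ℝ (Fin n))) := by simpa using hqC
    have h2 : q₁ - 0 ∈ (C : Set (EuclideanSpace ℝ (Fin n))) := by simpa using hx₁.subset hq₁
    have h3 : q₁ + d - 0 ∈ (C : Set (EuclideanSpace ℝ (Fin n))) := by simpa using hx₁.subset hqd₁
    have h4 : q₁ - (q₁ - q₂) ∈ (C : Set (EuclideanSpace ℝ (Fin n))) := by simpa using hx₂.subset hq₂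
    have h5 : q₁ + d - (q₁ - q₂) ∈ (C : Set (EuclideanSpace ℝ (Fin n))) := by
      have h : q₁ + d - (q₁ - q₂) = q₂ + d := by abel
      rw [h]
      exact hx₂.subset hqd₂
    have h6 : q₁ + d - q₁ ∈ (C : Set (EuclideanSpace ℝ (Fin n))) := by simpa using hdC
    rintro _ ⟨x, hx, y, hy, rfl⟩
    simp only [Set.mem_insert_iff, Set.mem_singleton_iff] at hx hy
    rcases hx with rfl | rfl | rfl | rfl <;> rcases hy with rfl | rfl | rfl | rfl <;>
      first
      | assumption
      | (apply hneg; assumption)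
      | (simpa only [sub_self] using h0)
  obtain ⟨K, hAK, hKC, hK⟩ := exists_isComplete C hsymm hC ⟨0, by simp⟩ hA
  have hv₁ : (0 : EuclideanSpace ℝ (Fin n)) ∈ K := hAK (by simp)
  have hv₂ : q₁ - q₂ ∈ K := hAK (by simp)
  have hu₁ : q₁ ∈ K := hAK (by simp)
  have hu₂ : q₁ + d ∈ K := hAK (by simp)
  have hdiam : 1 ≤ diameter (K : Set (EuclideanSpace ℝ (Fin n))) C := by
    have h := gauge_sub_le_diameter C.convex hsymm hC K.isCompact hu₁ hv₁
    rw [sub_zero] at h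
    exact (hx₁.one_le_gauge hsymm hC (hF₁.ne_of_isGaugeBody (by omega) hC) hq₁).trans h
  obtain ⟨x, hx, y, hy, hxy⟩ := subset_sub_of_isConstantWidth C K hsymm (hcw K hK) hdiam
    (hx₁.subset hp₁)
  have hKC' : ∀ {u v}, u ∈ K → v ∈ K → u - v ∈ (C : Set (EuclideanSpace ℝ (Fin n))) :=
    fun hu hv => hKC (Set.sub_mem_sub hu hv)
  simp only at hxy
  refine ⟨q₁ - y, ⟨?_, ?_⟩, q₁ + d - y, ⟨?_, ?_⟩, fun h => hd (by simpa using h)⟩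
  · exact hx₁.mem_of_add_eq_add hq₁ hp₁ (hKC' hu₁ hy) (hKC' hx hv₁) (by rw [← hxy]; abel)
  · exact hx₂.mem_of_add_eq_add hq₂ hp₂ (hKC' hu₁ hy) (hKC' hx hv₂) (by rw [← hxy]; abel)
  · exact hx₁.mem_of_add_eq_add hqd₁ hp₁ (hKC' hu₂ hy) (hKC' hx hv₁) (by rw [← hxy]; abel)
  · exact hx₂.mem_of_add_eq_add hqd₂ hp₂ (hKC' hu₂ hy) (hKC' hx hv₂) (by rw [← hxy]; abel)

end MinkowskiGeometry

theorem lemmal (n : ℕ) (hn : 3 ≤ n) (C : ConvexBody (EuclideanSpace ℝ (Fin n)))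
    (hpoly : MinkowskiGeometry.IsPolytope (C : Set (EuclideanSpace ℝ (Fin n))))
    (hsymm : -(C : Set (EuclideanSpace ℝ (Fin n))) = C)
    (hperf : MinkowskiGeometry.IsPerfect C)
    (F₁ F₂ : Set (EuclideanSpace ℝ (Fin n)))
    (hF₁ : MinkowskiGeometry.IsFacet (C : Set (EuclideanSpace ℝ (Fin n))) F₁)
    (hF₂ : MinkowskiGeometry.IsFacet (C : Set (EuclideanSpace ℝ (Fin n))) F₂)
    (hmeet : (F₁ ∩ F₂).Nonempty) :
    ∃ E : Set (EuclideanSpace ℝ (Fin n)),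
      MinkowskiGeometry.IsEdge (C : Set (EuclideanSpace ℝ (Fin n))) E ∧ E ⊆ F₁ ∩ F₂ := by
  obtain ⟨V, hV, hCV⟩ := hpoly
  have hexp := hF₁.2.1.inter hF₂.2.1
  have hnt := hperf.nontrivial_inter hn hsymm hF₁ hF₂ hmeet
  rw [hCV] at hexp
  obtain ⟨E, hE, hne, hEexp, hdim⟩ := hexp.exists_isExposed_finrank_eq_one hV hnt
  exact ⟨E, ⟨hne, hCV ▸ hEexp, hdim⟩, hE⟩
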